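/- Let $d,k$ be positive integers and let $\mathbf N^{(j)}=(N^{(j)}_1,\dots,N^{(j)}_d)\in\mathbb Z^d$, $j=1,\dots,k$, be vectors with non-negative entries. Let $\mathbf z=(z_1,\dots,z_d)$ be variables; for $\mathbf m=(m_1,\dots,m_d)\in\mathbb Z_{\ge0}^d$ write $\mathbf z^{\mathbf m}=z_1^{m_1}\cdots z_d^{m_d}$ and $\mathbf N^{(j)}\cdot\mathbf m=\sum_{i=1}^d N^{(j)}_i m_i$, and let $H_n=\sum_{r=1}^n 1/r$ (with $H_0=0$). Define the formal power series in $\mathbb Q[[\mathbf z]]$ $$F_{\mathbf N}(\mathbf z)=\sum_{\mathbf m\ge\mathbf 0}\mathbf z^{\mathbf m}\prod_{j=1}^k\frac{(\mathbf N^{(j)}\cdot\mathbf m)!}{\prod_{l=1}^d m_l!^{\,N^{(j)}_l}},$$ $$G_{i,\mathbf N}(\mathbf z)=\sum_{\mathbf m\ge\mathbf 0}\mathbf z^{\mathbf m}\Big(\sum_{j=1}^k N^{(j)}_i H_{\mathbf N^{(j)}\cdot\mathbf m}-H_{m_i}\sum_{j=1}^k N^{(j)}_i\Big)\prod_{j=1}^k\frac{(\mathbf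 N^{(j)}\cdot\mathbf m)!}{\prod_{l=1}^d m_l!^{\,N^{(j)}_l}},\qquad i=1,\dots,d.$$ The series $F_{\mathbf N}$ has constant term $1$ and each $G_{i,\mathbf N}$ has constant term $0$, so the canonical coordinates $$q_{i,\mathbf N}(\mathbf z)=z_i\exp\big(G_{i,\mathbf N}(\mathbf z)/F_{\mathbf N}(\mathbf z)\big),\qquad i=1,\dots,d,$$ are well-defined formal power series in $\mathbb Q[[\mathbf z]]$. Then $q_{i,\mathbf N}(\mathbf z)\in\mathbb Z[[\mathbf z]]$ for every $i=1,\dots,d$; that is, all coefficients of $q_{i,\mathbf N}$ are integers. -/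

import Mathlib

open scoped Nat

namespace MirrorMap

noncomputable section

/-- The product of multinomial coefficients
`∏_j (N^(j) · m)! / ∏_i (m_i)! ^ (N_i^(j))`, as a rational number. The family of vectors
`N^(1), …, N^(k)` with non-negative integer entries is `N`, with `N j i = N_i^(j)`. -/
def hyperCoeff {d k : ℕ} (N : Fin k → Fin d → ℕ) (m : Fin d →₀ ℕ) : ℚ :=
  ∏ j : Fin k, (((∑ i, N j i * m i)! : ℕ) : ℚ) / ∏ i, ((m i)! : ℚ) ^ N j i

/-- The series `F_N(z) = ∑_m z^m ∏_j (N^(j) · m)! / ∏_i (m_i)! ^ (N_i^(j))`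
in the variables `z_i`, `i : Fin d`. -/
def F {d k : ℕ} (N : Fin k → Fin d → ℕ) : MvPowerSeries (Fin d) ℚ :=
  fun m => hyperCoeff N m

/-- The series `G_{i,N}(z)`, the coefficient of `z^m` being
`(∑_j N_i^(j) H_{N^(j) · m} - H_{m_i} ∑_j N_i^(j)) ∏_j (N^(j) · m)! / ∏_l (m_l)! ^ (N_l^(j))`,
where `H_n = harmonic n` is the `n`-th harmonic number (`H_0 = 0`). -/
def G {d k : ℕ} (N : Fin k → Fin d → ℕ) (i : Fin d) : MvPowerSeries (Fin d) ℚ :=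
  fun m =>
    ((∑ j, (N j i : ℚ) * harmonic (∑ l, N j l * m l)) - harmonic (m i) * ∑ j, (N j i : ℚ)) *
      hyperCoeff N m

/-- The canonical coordinate `q_{i,N}(z) = z_i exp (G_{i,N}(z) / F_N(z))`, a formal power series
over `ℚ`; the exponential is substitution into the series `∑ X^n / n!`. -/
def canonicalCoord {d k : ℕ} (N : Fin k → Fin d → ℕ) (i : Fin d) : MvPowerSeries (Fin d) ℚ :=
  MvPowerSeries.X i * (PowerSeries.exp ℚ).subst (G N i * (F N)⁻¹)

/-- `F_N` has constant term `1`, so that `(F N)⁻¹` is its multiplicative inverse. -/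
theorem constantCoeff_F {d k : ℕ} (N : Fin k → Fin d → ℕ) :
    MvPowerSeries.constantCoeff (F N) = 1 := by
  rw [← MvPowerSeries.coeff_zero_eq_constantCoeff_apply]
  simp [MvPowerSeries.coeff_apply, F, hyperCoeff]

theorem F_mul_inv {d k : ℕ} (N : Fin k → Fin d → ℕ) : F N * (F N)⁻¹ = 1 :=
  MvPowerSeries.mul_inv_cancel _ (by simp [constantCoeff_F])

theorem constantCoeff_G {d k : ℕ} (N : Fin k → Fin d → ℕ) (i : Fin d) :
    MvPowerSeries.constantCoeff (G N i) = 0 := by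
  rw [← MvPowerSeries.coeff_zero_eq_constantCoeff_apply]
  simp [MvPowerSeries.coeff_apply, G]

/-- The substitution of `G_{i,N} / F_N` into the exponential series is legitimate. -/
theorem hasSubst_G_mul_inv {d k : ℕ} (N : Fin k → Fin d → ℕ) (i : Fin d) :
    PowerSeries.HasSubst (G N i * (F N)⁻¹) :=
  PowerSeries.HasSubst.of_constantCoeff_zero (by simp [constantCoeff_G])

end

end MirrorMap

namespace MirrorMap

open Finset.HasAntidiagonal (antidiagonal)

/-! Integrality is checked one prime p at a time. By Dwork's lemma (`exp_subst_mem`), exp g is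
p-integral once p divides g(z^p) - p g(z). For g = G/F, clearing the p-integral units F(z) and
F(z^p) turns this into p dividing F(z)G(z^p) - p F(z^p)G(z). That condition is additive in G, and G
is an integer combination of series Σ H_{L(m)} A(m) z^m, where A is `hyperCoeff N` and L is one of
the forms N^(j)·m or a coordinate.

At exponent a + pK with all a_i < p, the congruence p H_n ≡ H_⌊n/p⌋ mod p reduces the coefficient to
Σ_{k+l=K} H_{L(k)} (A(k)A(a+pl) - A(l)A(a+pk)). Without weights this sum vanishes by antisymmetry.
Summation by parts over the blocks ⌊k/p^s⌋ = m (`IsDworkSequence.sum_weight_mem`) then needs two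
facts: block sums are divisible by p^(s+1) A(m) (`IsDworkSequence.dworkSum_mem`), and this factor
makes the jumps of the harmonic weight divisible by p (`IsDworkSequence.harmonic_weight_mem`). Both
rest on splitting A(x)/A(⌊x/p⌋) into p-adic units and explicit factors created by carries. -/

/-- The rational numbers that are `p`-adically divisible by `c`. -/
def padicMultiples (p : ℕ) [Fact p.Prime] (c : ℚ) : AddSubgroup ℚ where
  carrier := {x | padicNorm p x ≤ padicNorm p c}
  zero_mem' := by simp [padicNorm.nonneg]
  add_mem' hx hy := padicNorm.nonarchimedean.trans (max_le hx hy)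
  neg_mem' hx := by simpa using hx

/-! ### Congruences between p-adically integral rationals -/

section padicMultiples

variable {p : ℕ} [Fact p.Prime] {a b c x y : ℚ}

theorem mem_padicMultiples : x ∈ padicMultiples p c ↔ padicNorm p x ≤ padicNorm p c := Iff.rfl

theorem mem_padicMultiples_one : x ∈ padicMultiples p 1 ↔ padicNorm p x ≤ 1 := by
  simp [mem_padicMultiples]

theorem self_mem_padicMultiples : c ∈ padicMultiples p c :=
  mem_padicMultiples.2 le_rfl

theorem padicMultiples_trans (hx : x ∈ padicMultiples p y) (hy : y ∈ padicMultiples p c) :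
    x ∈ padicMultiples p c :=
  mem_padicMultiples.2 ((mem_padicMultiples.1 hx).trans (mem_padicMultiples.1 hy))

theorem mul_mem_padicMultiples (hx : x ∈ padicMultiples p a) (hy : y ∈ padicMultiples p b) :
    x * y ∈ padicMultiples p (a * b) := by
  rw [mem_padicMultiples, padicNorm.mul, padicNorm.mul]
  exact mul_le_mul hx hy (padicNorm.nonneg _) (padicNorm.nonneg _)

theorem mul_mem_padicMultiples_left (hx : x ∈ padicMultiples p c) (hy : y ∈ padicMultiples p 1) :
    x * y ∈ padicMultiples p c := by
  simpa using mul_mem_padicMultiples hx hy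

theorem mul_mem_padicMultiples_right (hx : x ∈ padicMultiples p 1) (hy : y ∈ padicMultiples p c) :
    x * y ∈ padicMultiples p c := by
  simpa using mul_mem_padicMultiples hx hy

theorem div_mem_padicMultiples (hx : x ∈ padicMultiples p a) (c : ℚ) :
    x / c ∈ padicMultiples p (a / c) := by
  rw [mem_padicMultiples, padicNorm.div, padicNorm.div]
  exact div_le_div_of_nonneg_right hx (padicNorm.nonneg _)

theorem natCast_mem_padicMultiples_one (n : ℕ) : (n : ℚ) ∈ padicMultiples p 1 :=
  mem_padicMultiples_one.2 (padicNorm.of_nat n)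

theorem intCast_mem_padicMultiples_one (n : ℤ) : (n : ℚ) ∈ padicMultiples p 1 :=
  mem_padicMultiples_one.2 (padicNorm.of_int n)

theorem natCast_mem_padicMultiples_of_dvd {m n : ℕ} (h : m ∣ n) :
    (n : ℚ) ∈ padicMultiples p m := by
  obtain ⟨k, rfl⟩ := h
  push_cast
  exact mul_mem_padicMultiples_left self_mem_padicMultiples (natCast_mem_padicMultiples_one k)

theorem prod_mem_padicMultiples_one {ι : Type*} (s : Finset ι) (f : ι → ℚ)
    (h : ∀ i ∈ s, f i ∈ padicMultiples p 1) : ∏ i ∈ s, f i ∈ padicMultiples p 1 := by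
  classical
  induction s using Finset.induction_on with
  | empty => simpa using natCast_mem_padicMultiples_one (p := p) 1
  | insert i s hi ih =>
    rw [Finset.prod_insert hi]
    exact mul_mem_padicMultiples_right (h i (by simp)) (ih fun j hj => h j (by simp [hj]))

theorem pow_mem_padicMultiples_one (hx : x ∈ padicMultiples p 1) (n : ℕ) :
    x ^ n ∈ padicMultiples p 1 := by
  simpa using prod_mem_padicMultiples_one (Finset.range n) (fun _ => x) fun _ _ => hx

/-- Congruences modulo `c` between `p`-adic integers may be multiplied. -/
theorem mul_sub_mul_mem_padicMultiples {x' y' : ℚ} (hx : x - x' ∈ padicMultiples p c)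
    (hy : y - y' ∈ padicMultiples p c) (hy1 : y ∈ padicMultiples p 1)
    (hx1 : x' ∈ padicMultiples p 1) : x * y - x' * y' ∈ padicMultiples p c := by
  rw [show x * y - x' * y' = (x - x') * y + x' * (y - y') by ring]
  exact add_mem (mul_mem_padicMultiples_left hx hy1) (mul_mem_padicMultiples_right hx1 hy)

theorem prod_sub_prod_mem_padicMultiples {ι : Type*} (s : Finset ι) (f g : ι → ℚ)
    (hf : ∀ i ∈ s, f i ∈ padicMultiples p 1) (hg : ∀ i ∈ s, g i ∈ padicMultiples p 1)
    (h : ∀ i ∈ s, f i - g i ∈ padicMultiples p c) :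
    ∏ i ∈ s, f i - ∏ i ∈ s, g i ∈ padicMultiples p c := by
  classical
  induction s using Finset.induction_on with
  | empty => simp
  | insert i s hi ih =>
    rw [Finset.prod_insert hi, Finset.prod_insert hi]
    exact mul_sub_mul_mem_padicMultiples (h i (by simp))
      (ih (fun j hj => hf j (by simp [hj])) (fun j hj => hg j (by simp [hj]))
        fun j hj => h j (by simp [hj]))
      (prod_mem_padicMultiples_one _ _ fun j hj => hf j (by simp [hj])) (hg i (by simp))

theorem pow_sub_pow_mem_padicMultiples (h : x - y ∈ padicMultiples p c)
    (hx : x ∈ padicMultiples p 1) (hy : y ∈ padicMultiples p 1) (n : ℕ) :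
    x ^ n - y ^ n ∈ padicMultiples p c := by
  simpa using prod_sub_prod_mem_padicMultiples (Finset.range n) (fun _ => x) (fun _ => y)
    (fun _ _ => hx) (fun _ _ => hy) fun _ _ => h

end padicMultiples

/-- The coordinatewise integer quotient of an exponent vector by `n`. -/
noncomputable def floorQuot {σ : Type*} (n : ℕ) (m : σ →₀ ℕ) : σ →₀ ℕ :=
  m.mapRange (· / n) (Nat.zero_div n)

/-! ### Base-p blocks of exponent vectors -/

section floorQuot

variable {σ : Type*}

@[simp]
theorem floorQuot_apply (n : ℕ) (m : σ →₀ ℕ) (i : σ) : floorQuot n m i = m i / n := rfl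

@[simp]
theorem floorQuot_one (m : σ →₀ ℕ) : floorQuot 1 m = m := by
  ext i; simp

@[simp]
theorem floorQuot_zero_right (n : ℕ) : floorQuot n (0 : σ →₀ ℕ) = 0 := by
  ext i; simp

theorem floorQuot_floorQuot (a b : ℕ) (m : σ →₀ ℕ) :
    floorQuot a (floorQuot b m) = floorQuot (b * a) m := by
  ext i; simp [Nat.div_div_eq_div_mul]

theorem floorQuot_add_smul {n : ℕ} (hn : 0 < n) (k m : σ →₀ ℕ) :
    floorQuot n (k + n • m) = floorQuot n k + m := by
  ext i; simp [Nat.add_mul_div_left _ _ hn]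

theorem smul_floorQuot_le (n : ℕ) (m : σ →₀ ℕ) : n • floorQuot n m ≤ m := by
  intro i; simpa using Nat.mul_div_le (m i) n

theorem floorQuot_pow_eq_zero {p : ℕ} (hp : 1 < p) {k m : σ →₀ ℕ} (h : k ≤ m) :
    floorQuot (p ^ m.degree) k = 0 := by
  ext i
  have h1 : k i ≤ m.degree := (h i).trans (Finsupp.le_degree i m)
  simpa using Or.inr (h1.trans_lt (Nat.lt_pow_self hp))

end floorQuot

/-! ### Dwork's formal congruences in several variables -/

/-- The conditions on a multi-indexed sequence that imply Dwork's formal congruences. -/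
structure IsDworkSequence (p : ℕ) [Fact p.Prime] {σ : Type*} (A : (σ →₀ ℕ) → ℚ) : Prop where
  ne_zero : ∀ m, A m ≠ 0
  map_zero : A 0 = 1
  integral : ∀ m, A m ∈ padicMultiples p 1
  congr : ∀ s x n, floorQuot (p ^ (s + 1)) x = 0 →
    A (x + p ^ (s + 1) • n) - A (floorQuot p x + p ^ s • n) * (A x / A (floorQuot p x)) ∈
      padicMultiples p (p ^ (s + 1) * A n)

section Dwork

variable {σ : Type*} [DecidableEq σ] {p : ℕ}

/-- The antisymmetrised coefficient in Dwork's formal congruences. -/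
noncomputable def dworkTerm (p : ℕ) (A : (σ →₀ ℕ) → ℚ) (a k l : σ →₀ ℕ) : ℚ :=
  A k * A (a + p • l) - A l * A (a + p • k)

/-- The sum of `dworkTerm` over the block of indices whose quotient by `p ^ s` is `m`. -/
noncomputable def dworkSum (p : ℕ) (A : (σ →₀ ℕ) → ℚ) (a K : σ →₀ ℕ) (s : ℕ) (m : σ →₀ ℕ) : ℚ :=
  ∑ x ∈ antidiagonal K with floorQuot (p ^ s) x.1 = m, dworkTerm p A a x.1 x.2

theorem sum_dworkTerm_eq_zero (A : (σ →₀ ℕ) → ℚ) (a K : σ →₀ ℕ) :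
    ∑ x ∈ antidiagonal K, dworkTerm p A a x.1 x.2 = 0 := by
  simp only [dworkTerm, Finset.sum_sub_distrib]
  rw [sub_eq_zero]
  conv_rhs => rw [← Finset.HasAntidiagonal.map_swap_antidiagonal, Finset.sum_map]
  rfl

/-- A weight that is constant on blocks factors out of each block sum. -/
theorem sum_mul_dworkTerm_mem {A : (σ →₀ ℕ) → ℚ} {a K : σ →₀ ℕ} {H : AddSubgroup ℚ} {t : ℕ}
    (f : (σ →₀ ℕ) → ℚ) (h : ∀ j, f j * dworkSum p A a K t j ∈ H) :
    ∑ x ∈ antidiagonal K, f (floorQuot (p ^ t) x.1) * dworkTerm p A a x.1 x.2 ∈ H := by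
  rw [← Finset.sum_fiberwise_of_maps_to (g := fun x => floorQuot (p ^ t) x.1)
    (t := (antidiagonal K).image fun x => floorQuot (p ^ t) x.1)
    fun x hx => Finset.mem_image_of_mem _ hx]
  refine sum_mem fun j _ => ?_
  convert h j using 1
  rw [dworkSum, Finset.mul_sum]
  refine Finset.sum_congr rfl fun x hx => ?_
  rw [(Finset.mem_filter.1 hx).2]

theorem dworkSum_eq_zero (A : (σ →₀ ℕ) → ℚ) (a : σ →₀ ℕ) {K m : σ →₀ ℕ} {s : ℕ}
    (h : ¬ p ^ s • m ≤ K) : dworkSum p A a K s m = 0 := by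
  refine Finset.sum_eq_zero fun x hx => absurd ?_ h
  rw [Finset.mem_filter, Finset.HasAntidiagonal.mem_antidiagonal] at hx
  rw [← hx.2, ← hx.1]
  exact (smul_floorQuot_le _ _).trans le_self_add

theorem dworkSum_add_smul (hp : 0 < p) (A : (σ →₀ ℕ) → ℚ) (a K m : σ →₀ ℕ) (s : ℕ) :
    dworkSum p A a (K + p ^ s • m) s m =
      ∑ x ∈ antidiagonal K with floorQuot (p ^ s) x.1 = 0,
        dworkTerm p A a (x.1 + p ^ s • m) x.2 := by
  symm
  refine Finset.sum_bij' (fun x _ => (x.1 + p ^ s • m, x.2)) (fun x _ => (x.1 - p ^ s • m, x.2))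
    ?_ ?_ ?_ ?_ ?_
  · rintro ⟨k, l⟩ hx
    rw [Finset.mem_filter, Finset.HasAntidiagonal.mem_antidiagonal] at hx ⊢
    rw [floorQuot_add_smul (by positivity), hx.2, ← hx.1]
    simp only [zero_add, and_true]
    abel
  · rintro ⟨k, l⟩ hx
    rw [Finset.mem_filter, Finset.HasAntidiagonal.mem_antidiagonal] at hx ⊢
    obtain ⟨h1, h2⟩ := hx
    dsimp only at h1 h2 ⊢
    have h3 : p ^ s • m ≤ k := h2 ▸ smul_floorQuot_le _ _
    obtain ⟨j, rfl⟩ := exists_add_of_le h3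
    rw [add_comm _ j, floorQuot_add_smul (by positivity)] at h2
    rw [add_tsub_cancel_left]
    refine ⟨?_, by simpa using h2⟩
    refine add_right_cancel (b := p ^ s • m) ?_
    rw [← h1]
    abel
  · rintro ⟨k, l⟩ hx
    simp
  · rintro ⟨k, l⟩ hx
    rw [Finset.mem_filter] at hx
    have h3 : p ^ s • m ≤ k := by
      have := hx.2
      dsimp only at this
      exact this ▸ smul_floorQuot_le _ _
    simp [tsub_add_cancel_of_le h3]
  · rintro ⟨k, l⟩ hx
    rfl

variable [Fact p.Prime] {A : (σ →₀ ℕ) → ℚ}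

/-- The ratio `A (x + p ^ r • m) / A x` for `x` in the fundamental block, and `0` elsewhere. -/
noncomputable def blockRatio (p : ℕ) (A : (σ →₀ ℕ) → ℚ) (m : σ →₀ ℕ) (r : ℕ) (x : σ →₀ ℕ) : ℚ :=
  if floorQuot (p ^ r) x = 0 then A (x + p ^ r • m) / A x else 0

/-- This is `congr` divided by `A x`. The denominator `A x` in the modulus is later cancelled by the
divisibility of the block sum indexed by `x`. -/
theorem IsDworkSequence.blockRatio_succ_sub (hA : IsDworkSequence p A) (m x : σ →₀ ℕ) (r : ℕ) :
    blockRatio p A m (r + 1) x - blockRatio p A m r (floorQuot p x) ∈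
      padicMultiples p (p ^ (r + 1) * A m / A x) := by
  unfold blockRatio
  rw [floorQuot_floorQuot, ← pow_succ']
  split_ifs with h
  · convert div_mem_padicMultiples (hA.congr r x m h) (A x) using 1
    field_simp [hA.ne_zero]
  · simp

/-- Level s is traded for coarser blocks one step at a time, `t` growing as `r` falls. A step costs
ratio differences times level-`t` block sums, and `A j` cancels in (p^(r+1) A(m)/A(j)) · p^(t+1)
A(j). -/
theorem IsDworkSequence.dworkSum_add_smul_sub (hA : IsDworkSequence p A) {a : σ →₀ ℕ}
    (ha : floorQuot p a = 0) {s : ℕ}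
    (ih : ∀ t < s, ∀ K m, dworkSum p A a K t m ∈ padicMultiples p (p ^ (t + 1) * A m))
    (K m : σ →₀ ℕ) {t r : ℕ} (hrt : r + t = s) :
    dworkSum p A a (K + p ^ s • m) s m - ∑ x ∈ antidiagonal K,
        blockRatio p A m r (floorQuot (p ^ t) x.1) * dworkTerm p A a x.1 x.2 ∈
      padicMultiples p (p ^ (s + 1) * A m) := by
  have hp : 0 < p := (Fact.out : p.Prime).pos
  induction t generalizing r with
  | zero =>
    obtain rfl : r = s := by simpa using hrt
    rw [dworkSum_add_smul hp, Finset.sum_filter, ← Finset.sum_sub_distrib]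
    refine sum_mem fun x _ => ?_
    unfold blockRatio
    simp only [pow_zero, floorQuot_one]
    split_ifs with h
    · have hq : floorQuot p (a + p • x.1) = x.1 := by rw [floorQuot_add_smul hp, ha, zero_add]
      -- The vector a + p x lies in the fundamental block of level r + 1 and has quotient x.
      have h1 := hA.congr r (a + p • x.1) m (by
        rw [pow_succ', ← floorQuot_floorQuot, hq, h])
      rw [hq] at h1
      have h2 := neg_mem (mul_mem_padicMultiples_left h1 (hA.integral x.2))
      convert h2 using 1
      have h3 : a + p • (x.1 + p ^ r • m) = a + p • x.1 + p ^ (r + 1) • m := by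
        rw [smul_add, smul_smul, ← pow_succ', add_assoc]
      simp only [dworkTerm, h3]
      field_simp [hA.ne_zero]
      ring
    · simp
  | succ t iht =>
    have h1 := iht (r := r + 1) (by omega)
    rw [← sub_add_sub_cancel _ (∑ x ∈ antidiagonal K,
        blockRatio p A m (r + 1) (floorQuot (p ^ t) x.1) * dworkTerm p A a x.1 x.2)]
    refine add_mem h1 ?_
    rw [← Finset.sum_sub_distrib]
    have h2 := sum_mul_dworkTerm_mem (p := p) (A := A) (a := a) (K := K) (t := t)
      (H := padicMultiples p (p ^ (s + 1) * A m))
      (fun j => blockRatio p A m (r + 1) j - blockRatio p A m r (floorQuot p j)) (fun j => by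
        have := mul_mem_padicMultiples (hA.blockRatio_succ_sub m j r) (ih t (by omega) K j)
        convert this using 2
        rw [← hrt]
        field_simp [hA.ne_zero]
        ring)
    convert h2 using 1
    refine Finset.sum_congr rfl fun x _ => ?_
    rw [floorQuot_floorQuot, ← pow_succ]
    ring

/-- Dwork's formal congruences. -/
theorem IsDworkSequence.dworkSum_mem (hA : IsDworkSequence p A) {a : σ →₀ ℕ}
    (ha : floorQuot p a = 0) (s : ℕ) (K m : σ →₀ ℕ) :
    dworkSum p A a K s m ∈ padicMultiples p (p ^ (s + 1) * A m) := by
  have hp : 0 < p := (Fact.out : p.Prime).pos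
  induction s using Nat.strong_induction_on generalizing K m with
  | _ s ih =>
  have key (K m : σ →₀ ℕ) : dworkSum p A a (K + p ^ s • m) s m - A m * dworkSum p A a K s 0 ∈
      padicMultiples p (p ^ (s + 1) * A m) := by
    -- At r = 0 the block ratio is `A m` at index 0 and vanishes elsewhere.
    convert hA.dworkSum_add_smul_sub ha ih K m (t := s) (r := 0) (zero_add s) using 2
    rw [dworkSum, Finset.sum_filter, Finset.mul_sum]
    refine Finset.sum_congr rfl fun x _ => ?_
    unfold blockRatio
    simp only [pow_zero, floorQuot_one, one_smul]
    split_ifs with h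
    · rw [h, hA.map_zero, zero_add, div_one]
    · simp
  have of_zero (K m : σ →₀ ℕ)
      (h : ∀ K', K' + p ^ s • m = K → dworkSum p A a K' s 0 ∈ padicMultiples p (p ^ (s + 1))) :
      dworkSum p A a K s m ∈ padicMultiples p (p ^ (s + 1) * A m) := by
    by_cases hK : p ^ s • m ≤ K
    · obtain ⟨K', rfl⟩ := exists_add_of_le hK
      rw [add_comm _ K'] at *
      have h1 := mul_mem_padicMultiples (h K' rfl) (self_mem_padicMultiples (p := p) (c := A m))
      have h2 := add_mem (key K' m) h1
      rwa [mul_comm (dworkSum p A a K' s 0), sub_add_cancel] at h2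
    · rw [dworkSum_eq_zero A a hK]
      exact zero_mem _
  -- All block sums add up to zero, so block 0 is minus the sum of the others, and these reduce to
  -- block 0 for a smaller K.
  have hzero (K : σ →₀ ℕ) : dworkSum p A a K s 0 ∈ padicMultiples p (p ^ (s + 1)) := by
    induction K using WellFoundedLT.induction with
    | _ K ihK =>
    have h1 := sum_dworkTerm_eq_zero (p := p) A a K
    rw [← Finset.sum_fiberwise_of_maps_to (g := fun x => floorQuot (p ^ s) x.1)
      (t := (antidiagonal K).image fun x => floorQuot (p ^ s) x.1)
      fun x hx => Finset.mem_image_of_mem _ hx, ← Finset.add_sum_erase _ _ (a := 0)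
      (Finset.mem_image.2 ⟨(0, K), by simp, by simp⟩)] at h1
    change dworkSum p A a K s 0 + _ = 0 at h1
    rw [eq_neg_of_add_eq_zero_left h1]
    refine neg_mem (sum_mem fun m hm => ?_)
    have hm0 : m ≠ 0 := (Finset.mem_erase.1 hm).1
    have h2 := of_zero K m fun K' hK' => ihK K' (by
      rw [← hK']
      refine lt_add_of_pos_right _ (pos_iff_ne_zero.2 ?_)
      simpa [hp.ne'] using hm0)
    exact padicMultiples_trans h2
      (mul_mem_padicMultiples_left self_mem_padicMultiples (hA.integral m))
  exact of_zero K m fun K' _ => hzero K'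

/-- Summation by parts: W(k) telescopes through the values W(p^s ⌊k/p^s⌋), whose successive
differences are constant on blocks of level s. -/
theorem IsDworkSequence.sum_weight_mem (hA : IsDworkSequence p A) {a : σ →₀ ℕ}
    (ha : floorQuot p a = 0) (W : (σ →₀ ℕ) → ℚ) {c : ℚ}
    (hW : ∀ s m, (W (p ^ s • m) - W (p ^ (s + 1) • floorQuot p m)) * (p ^ (s + 1) * A m) ∈
      padicMultiples p c) (K : σ →₀ ℕ) :
    ∑ x ∈ antidiagonal K, W x.1 * dworkTerm p A a x.1 x.2 ∈ padicMultiples p c := by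
  have hp : 1 < p := (Fact.out : p.Prime).one_lt
  have h (s : ℕ) : ∑ x ∈ antidiagonal K,
      (W x.1 - W (p ^ s • floorQuot (p ^ s) x.1)) * dworkTerm p A a x.1 x.2 ∈
        padicMultiples p c := by
    induction s with
    | zero => simp
    | succ s ih =>
      have h1 := sum_mul_dworkTerm_mem (p := p) (A := A) (a := a) (K := K) (t := s)
        (H := padicMultiples p c)
        (fun j => W (p ^ s • j) - W (p ^ (s + 1) • floorQuot p j)) (fun j =>
          padicMultiples_trans
            (mul_mem_padicMultiples self_mem_padicMultiples (hA.dworkSum_mem ha s K j)) (hW s j))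
      convert add_mem ih h1 using 1
      rw [← Finset.sum_add_distrib]
      refine Finset.sum_congr rfl fun x _ => ?_
      rw [floorQuot_floorQuot, ← pow_succ]
      ring
  -- At this level every k ≤ K has quotient 0, and the constant weight `W 0` contributes nothing.
  convert h K.degree using 1
  have h0 := congrArg (W 0 * ·) (sum_dworkTerm_eq_zero (p := p) A a K)
  simp only [mul_zero, Finset.mul_sum] at h0
  rw [← sub_zero (∑ x ∈ antidiagonal K, W x.1 * dworkTerm p A a x.1 x.2), ← h0,
    ← Finset.sum_sub_distrib]
  refine Finset.sum_congr rfl fun x hx => ?_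
  rw [floorQuot_pow_eq_zero hp (Finset.HasAntidiagonal.antidiagonal.fst_le hx), smul_zero, sub_mul]

end Dwork

/-! ### Factorials and harmonic numbers modulo powers of p -/

section Factorial

variable {p : ℕ} {c : ℚ}

/-- The product of the positive integers up to `n` that are not divisible by `p`. -/
def primeToFactorial (p : ℕ) : ℕ → ℕ
  | 0 => 1
  | n + 1 => if p ∣ n + 1 then primeToFactorial p n else primeToFactorial p n * (n + 1)

theorem factorial_eq_primeToFactorial (p n : ℕ) :
    n ! = p ^ (n / p) * (n / p)! * primeToFactorial p n := by
  induction n with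
  | zero => simp [primeToFactorial]
  | succ n ih =>
    rw [Nat.factorial_succ, ih, primeToFactorial, Nat.succ_div]
    split_ifs with h
    · have h1 : p * (n / p + 1) = n + 1 := by
        have h2 : (n + 1) / p = n / p + 1 := by rw [Nat.succ_div, if_pos h]
        rw [← h2, Nat.mul_div_cancel' h]
      rw [← h1, Nat.factorial_succ, pow_succ]
      ring
    · rw [add_zero]
      ring

/-- As p divides P, a shift by P preserves both the residue of a factor modulo P and its
divisibility by p. -/
theorem primeToFactorial_add_modEq {P : ℕ} (hP : p ∣ P) (x : ℕ) :
    primeToFactorial p (P + x) ≡ primeToFactorial p P * primeToFactorial p x [MOD P] := by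
  induction x with
  | zero => simp [primeToFactorial, Nat.ModEq.refl]
  | succ x ih =>
    rw [← add_assoc, primeToFactorial, primeToFactorial, add_assoc P]
    simp only [Nat.dvd_add_right hP]
    split_ifs with h
    · exact ih
    · rw [← mul_assoc]
      refine ih.mul ?_
      simp [Nat.ModEq]

theorem primeToFactorial_add_mul_modEq {P : ℕ} (hP : p ∣ P) (x t : ℕ) :
    primeToFactorial p (x + P * t) ≡ primeToFactorial p x * primeToFactorial p P ^ t [MOD P] := by
  induction t with
  | zero => simp [Nat.ModEq.refl]
  | succ t ih =>
    rw [show x + P * (t + 1) = P + (x + P * t) by ring]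
    refine (primeToFactorial_add_modEq hP _).trans ?_
    rw [pow_succ, ← mul_assoc, mul_comm]
    exact ih.mul_right _

theorem ascFactorial_modEq {a b n : ℕ} (h : a ≡ b [MOD n]) (k : ℕ) :
    a.ascFactorial k ≡ b.ascFactorial k [MOD n] := by
  induction k with
  | zero => simp [Nat.ModEq.refl]
  | succ k ih =>
    rw [Nat.ascFactorial_succ, Nat.ascFactorial_succ]
    exact (h.add_right k).mul ih

variable [Fact p.Prime]

theorem padicNorm_primeToFactorial (n : ℕ) : padicNorm p (primeToFactorial p n) = 1 := by
  induction n with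
  | zero => simp [primeToFactorial]
  | succ n ih =>
    rw [primeToFactorial]
    split_ifs with h
    · exact ih
    · rw [Nat.cast_mul, padicNorm.mul, ih, one_mul, padicNorm.nat_eq_one_iff]
      exact h

theorem natCast_sub_natCast_mem {a b n : ℕ} (h : a ≡ b [MOD n]) :
    (a - b : ℚ) ∈ padicMultiples p n := by
  obtain ⟨k, hk⟩ := (Nat.modEq_iff_dvd.1 h.symm)
  have h1 : (a - b : ℚ) = n * (k : ℤ) := by exact_mod_cast hk
  rw [h1]
  exact mul_mem_padicMultiples_left self_mem_padicMultiples (intCast_mem_padicMultiples_one k)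

theorem div_sub_div_mem_padicMultiples {x y u v : ℚ} (hx : x - y ∈ padicMultiples p c)
    (hu : u - v ∈ padicMultiples p c) (hy1 : padicNorm p y ≤ 1) (hu1 : padicNorm p u = 1)
    (hv1 : padicNorm p v = 1) : x / u - y / v ∈ padicMultiples p c := by
  have hu0 : u ≠ 0 := by rintro rfl; simp at hu1
  have hv0 : v ≠ 0 := by rintro rfl; simp at hv1
  have huv : padicNorm p (u * v) = 1 := by rw [padicNorm.mul, hu1, hv1, one_mul]
  have h1 : x * v - y * u ∈ padicMultiples p c := by
    rw [show x * v - y * u = (x - y) * v - y * (u - v) by ring]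
    exact sub_mem (mul_mem_padicMultiples_left hx (mem_padicMultiples_one.2 hv1.le))
      (mul_mem_padicMultiples_right (mem_padicMultiples_one.2 hy1) hu)
  rw [mem_padicMultiples] at h1 ⊢
  rwa [div_sub_div _ _ hu0 hv0, padicNorm.div, huv, div_one, mul_comm u]

/-- `p H_n` is congruent to `H_⌊n/p⌋` modulo `p`. -/
theorem mul_harmonic_sub_mem (n : ℕ) :
    p * harmonic n - harmonic (n / p) ∈ padicMultiples p p := by
  have hp : p ≠ 0 := (Fact.out : p.Prime).ne_zero
  induction n with
  | zero => simp
  | succ n ih =>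
    rw [harmonic_succ, Nat.succ_div]
    split_ifs with h
    · have h1 : p * (n / p + 1) = n + 1 := by
        have h2 : (n + 1) / p = n / p + 1 := by rw [Nat.succ_div, if_pos h]
        rw [← h2, Nat.mul_div_cancel' h]
      rw [harmonic_succ, ← h1]
      convert ih using 1
      push_cast
      have : (((n / p : ℕ) : ℚ) + 1) ≠ 0 := by positivity
      field_simp
      ring
    · rw [add_zero, mul_add, add_sub_right_comm]
      refine add_mem ih (mul_mem_padicMultiples_left self_mem_padicMultiples ?_)
      have h1 : padicNorm p ((n + 1 : ℕ) : ℚ) = 1 := (padicNorm.nat_eq_one_iff _).2 h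
      rw [mem_padicMultiples_one, ← one_div, padicNorm.div, h1]
      simp

theorem pow_mul_harmonic_sub_mem (s n : ℕ) :
    p ^ s * harmonic (p ^ s * n) - harmonic n ∈ padicMultiples p p := by
  have hp : 0 < p := (Fact.out : p.Prime).pos
  induction s with
  | zero => simp
  | succ s ih =>
    have h1 := mul_harmonic_sub_mem (p := p) (p ^ (s + 1) * n)
    rw [pow_succ', mul_assoc, Nat.mul_div_cancel_left _ hp] at h1
    convert add_mem (mul_mem_padicMultiples_right
      (natCast_mem_padicMultiples_one (p := p) (p ^ s)) h1) ih using 1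
    rw [pow_succ' p, mul_assoc]
    push_cast
    ring

end Factorial

/-! ### The ratio of one multinomial factor at x and ⌊x/p⌋ -/

section Multinomial

variable {σ : Type*} [Fintype σ] {p : ℕ}

/-- The linear form `m ↦ ∑ i, ν i * m i`. -/
noncomputable def linearForm (ν : σ → ℕ) : (σ →₀ ℕ) →+ ℕ where
  toFun m := ∑ i, ν i * m i
  map_zero' := by simp
  map_add' a b := by simp [mul_add, Finset.sum_add_distrib]

theorem linearForm_apply (ν : σ → ℕ) (m : σ →₀ ℕ) : linearForm ν m = ∑ i, ν i * m i := rfl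

/-- The quotient `(ν · m)! / ∏ i, (m i)! ^ ν i`. -/
noncomputable def multiCoeff (ν : σ → ℕ) (m : σ →₀ ℕ) : ℚ :=
  ((linearForm ν m)! : ℚ) / ∏ i, ((m i)! : ℚ) ^ ν i

theorem multiCoeff_pos (ν : σ → ℕ) (m : σ →₀ ℕ) : 0 < multiCoeff ν m := by
  unfold multiCoeff
  have (i : σ) : (0 : ℚ) < (m i)! := by exact_mod_cast Nat.factorial_pos _
  have h : (0 : ℚ) < (linearForm ν m)! := by exact_mod_cast Nat.factorial_pos _
  exact div_pos h (Finset.prod_pos fun i _ => pow_pos (this i) _)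

/-- The excess of `⌊ν · x / p⌋` over `ν · ⌊x / p⌋`. -/
noncomputable def carry (p : ℕ) (ν : σ → ℕ) (x : σ →₀ ℕ) : ℕ :=
  linearForm ν x / p - linearForm ν (floorQuot p x)

theorem linearForm_floorQuot_add_carry (hp : 0 < p) (ν : σ → ℕ) (x : σ →₀ ℕ) :
    linearForm ν (floorQuot p x) + carry p ν x = linearForm ν x / p := by
  refine Nat.add_sub_cancel' ((Nat.le_div_iff_mul_le hp).2 ?_)
  rw [linearForm_apply, linearForm_apply, Finset.sum_mul]
  refine Finset.sum_le_sum fun i _ => ?_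
  rw [mul_assoc]
  exact Nat.mul_le_mul_left _ (Nat.div_mul_le_self _ _)

theorem carry_add_smul (hp : 0 < p) (ν : σ → ℕ) (x n : σ →₀ ℕ) (s : ℕ) :
    carry p ν (x + p ^ (s + 1) • n) = carry p ν x := by
  unfold carry
  rw [pow_succ', mul_smul, floorQuot_add_smul hp]
  simp only [map_add, map_nsmul, smul_eq_mul]
  rw [Nat.add_mul_div_left _ _ hp, Nat.add_sub_add_right]

/-- The factor of `multiCoeff ν x / multiCoeff ν ⌊x / p⌋` that carries its `p`-part. -/
noncomputable def carryFactor (p : ℕ) (ν : σ → ℕ) (x : σ →₀ ℕ) : ℕ :=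
  p ^ carry p ν x * (linearForm ν (floorQuot p x) + 1).ascFactorial (carry p ν x)

/-- The factor of `multiCoeff ν x / multiCoeff ν ⌊x / p⌋` that is a `p`-adic unit. -/
noncomputable def unitFactor (p : ℕ) (ν : σ → ℕ) (x : σ →₀ ℕ) : ℚ :=
  primeToFactorial p (linearForm ν x) / ∏ i, (primeToFactorial p (x i) : ℚ) ^ ν i

/-- After n! is split into p^⌊n/p⌋, ⌊n/p⌋! and a unit, numerator and denominator differ in their
powers of p by the carry, and the surplus of the factorial is a rising factorial. -/
theorem multiCoeff_eq (hp : p.Prime) (ν : σ → ℕ) (x : σ →₀ ℕ) :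
    multiCoeff ν x = multiCoeff ν (floorQuot p x) * (carryFactor p ν x * unitFactor p ν x) := by
  have := Fact.mk hp
  have hp0 : (p : ℚ) ≠ 0 := by exact_mod_cast hp.ne_zero
  have h0 (n : ℕ) : (primeToFactorial p n : ℚ) ≠ 0 := fun h => by
    have := padicNorm_primeToFactorial (p := p) n
    simp [h] at this
  have h1 : ((linearForm ν x)! : ℚ) = p ^ linearForm ν (floorQuot p x) *
      ((linearForm ν (floorQuot p x))! * (carryFactor p ν x *
        primeToFactorial p (linearForm ν x))) := by
    have h2 := factorial_eq_primeToFactorial p (linearForm ν x)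
    rw [← linearForm_floorQuot_add_carry hp.pos, ← Nat.factorial_mul_ascFactorial, pow_add] at h2
    rw [h2, carryFactor]
    push_cast
    ring
  have h3 : ∏ i, ((x i)! : ℚ) ^ ν i = p ^ linearForm ν (floorQuot p x) *
      ((∏ i, ((floorQuot p x i)! : ℚ) ^ ν i) * ∏ i, (primeToFactorial p (x i) : ℚ) ^ ν i) := by
    rw [linearForm_apply, ← Finset.prod_pow_eq_pow_sum, ← Finset.prod_mul_distrib,
      ← Finset.prod_mul_distrib]
    refine Finset.prod_congr rfl fun i _ => ?_
    rw [factorial_eq_primeToFactorial p (x i), floorQuot_apply, mul_comm (ν i), pow_mul]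
    push_cast
    rw [mul_pow, mul_pow, mul_assoc]
  rw [multiCoeff, h1, h3, mul_div_mul_left _ _ (pow_ne_zero _ hp0), mul_div_mul_comm,
    multiCoeff, unitFactor, mul_div_assoc]

variable [Fact p.Prime]

theorem padicNorm_prod_primeToFactorial (ν : σ → ℕ) (x : σ →₀ ℕ) :
    padicNorm p (∏ i, (primeToFactorial p (x i) : ℚ) ^ ν i) = 1 := by
  have h : (∏ i, (primeToFactorial p (x i) : ℚ) ^ ν i) =
      ((∏ i, primeToFactorial p (x i) ^ ν i : ℕ) : ℚ) := by push_cast; rfl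
  rw [h, padicNorm.nat_eq_one_iff, Prime.dvd_finsetProd_iff (Nat.prime_iff.1 Fact.out)]
  rintro ⟨i, -, hi⟩
  exact (padicNorm.nat_eq_one_iff _).1 (padicNorm_primeToFactorial (p := p) (x i))
    ((Fact.out : p.Prime).dvd_of_dvd_pow hi)

theorem unitFactor_mem (ν : σ → ℕ) (x : σ →₀ ℕ) : unitFactor p ν x ∈ padicMultiples p 1 := by
  rw [mem_padicMultiples_one, unitFactor, padicNorm.div, padicNorm_prod_primeToFactorial,
    padicNorm_primeToFactorial]
  simp

/-- Modulo P = p^(s+1), numerator and denominator acquire the same unit, the (ν·n)-th power of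
`primeToFactorial p P`, so its residue is never needed. -/
theorem unitFactor_add_smul_sub (ν : σ → ℕ) (x n : σ →₀ ℕ) (s : ℕ) :
    unitFactor p ν (x + p ^ (s + 1) • n) - unitFactor p ν x ∈
      padicMultiples p (p ^ (s + 1) : ℕ) := by
  have hP : p ∣ p ^ (s + 1) := dvd_pow_self p (Nat.succ_ne_zero s)
  set P := p ^ (s + 1)
  have hw : (primeToFactorial p P : ℚ) ≠ 0 := fun h => by
    have := padicNorm_primeToFactorial (p := p) P
    simp [h] at this
  have h1 : unitFactor p ν x = (primeToFactorial p (linearForm ν x) *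
        primeToFactorial p P ^ linearForm ν n : ℚ) /
      ∏ i, (primeToFactorial p (x i) * primeToFactorial p P ^ n i : ℚ) ^ ν i := by
    simp only [mul_pow, Finset.prod_mul_distrib, ← pow_mul]
    rw [Finset.prod_pow_eq_pow_sum, linearForm_apply ν n]
    simp only [mul_comm (n _)]
    rw [mul_div_mul_right _ _ (pow_ne_zero _ hw), unitFactor]
  have hN (i : σ) : padicNorm p (primeToFactorial p (x i) * primeToFactorial p P ^ n i : ℚ) = 1 := by
    rw [padicNorm.mul, padicNorm_primeToFactorial, one_mul, ← Nat.cast_pow,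
      padicNorm.nat_eq_one_iff]
    exact fun h => (padicNorm.nat_eq_one_iff _).1 (padicNorm_primeToFactorial (p := p) P)
      ((Fact.out : p.Prime).dvd_of_dvd_pow h)
  rw [h1, unitFactor]
  refine div_sub_div_mem_padicMultiples ?_ ?_ ?_ (padicNorm_prod_primeToFactorial _ _) ?_
  · rw [map_add, map_nsmul, smul_eq_mul]
    exact_mod_cast natCast_sub_natCast_mem (primeToFactorial_add_mul_modEq hP _ _)
  · refine prod_sub_prod_mem_padicMultiples _ _ _ (fun i _ => ?_) (fun i _ => ?_) fun i _ => ?_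
    · exact pow_mem_padicMultiples_one (natCast_mem_padicMultiples_one _) _
    · exact pow_mem_padicMultiples_one (mem_padicMultiples_one.2 (hN i).le) _
    · refine pow_sub_pow_mem_padicMultiples ?_ (natCast_mem_padicMultiples_one _)
        (mem_padicMultiples_one.2 (hN i).le) _
      exact_mod_cast natCast_sub_natCast_mem (primeToFactorial_add_mul_modEq hP (x i) (n i))
  · exact_mod_cast padicNorm.of_nat _
  · have h2 : ∏ i, (primeToFactorial p (x i) * primeToFactorial p P ^ n i : ℚ) ^ ν i =
        (∏ i, (primeToFactorial p (x i) : ℚ) ^ ν i) * primeToFactorial p P ^ linearForm ν n := by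
      simp only [mul_pow, Finset.prod_mul_distrib, ← pow_mul]
      rw [Finset.prod_pow_eq_pow_sum, linearForm_apply ν n]
      simp only [mul_comm (n _)]
    rw [h2, padicNorm.mul, padicNorm_prod_primeToFactorial, one_mul, ← Nat.cast_pow,
      padicNorm.nat_eq_one_iff]
    exact fun h => (padicNorm.nat_eq_one_iff _).1 (padicNorm_primeToFactorial (p := p) P)
      ((Fact.out : p.Prime).dvd_of_dvd_pow h)

/-- The rising factorial is only controlled modulo p^s; a positive carry supplies the missing p, and
with no carry both factors are 1. -/
theorem carryFactor_add_smul_sub (ν : σ → ℕ) (x n : σ →₀ ℕ) (s : ℕ) :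
    (carryFactor p ν (x + p ^ (s + 1) • n) - carryFactor p ν x : ℚ) ∈
      padicMultiples p (p ^ (s + 1) : ℕ) := by
  have hp : 0 < p := (Fact.out : p.Prime).pos
  refine natCast_sub_natCast_mem ?_
  rw [carryFactor, carryFactor, carry_add_smul hp]
  rcases Nat.eq_zero_or_pos (carry p ν x) with h | h
  · simp [h, Nat.ModEq.refl]
  · obtain ⟨c, hc⟩ := Nat.exists_eq_add_of_lt h
    rw [hc, zero_add]
    have h1 : linearForm ν (floorQuot p (x + p ^ (s + 1) • n)) + 1 ≡
        linearForm ν (floorQuot p x) + 1 [MOD p ^ s] := by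
      rw [pow_succ' p, mul_smul, floorQuot_add_smul hp, map_add, map_nsmul, smul_eq_mul]
      simp [Nat.ModEq, add_right_comm]
    have h2 := ((ascFactorial_modEq h1 (c + 1)).mul_left' p).mul_left (p ^ c)
    rw [← pow_succ' p, ← mul_assoc, ← mul_assoc, ← pow_succ] at h2
    exact h2

/-- The ratio `multiCoeff ν x / multiCoeff ν ⌊x / p⌋`. -/
noncomputable def coeffRatio (p : ℕ) (ν : σ → ℕ) (x : σ →₀ ℕ) : ℚ :=
  carryFactor p ν x * unitFactor p ν x

theorem coeffRatio_mem (ν : σ → ℕ) (x : σ →₀ ℕ) : coeffRatio p ν x ∈ padicMultiples p 1 :=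
  mul_mem_padicMultiples_left (natCast_mem_padicMultiples_one _) (unitFactor_mem ν x)

theorem coeffRatio_add_smul_sub (ν : σ → ℕ) (x n : σ →₀ ℕ) (s : ℕ) :
    coeffRatio p ν (x + p ^ (s + 1) • n) - coeffRatio p ν x ∈
      padicMultiples p (p ^ (s + 1) : ℕ) :=
  mul_sub_mul_mem_padicMultiples (carryFactor_add_smul_sub ν x n s)
    (unitFactor_add_smul_sub ν x n s) (unitFactor_mem _ _) (natCast_mem_padicMultiples_one _)

theorem coeffRatio_div_mem (ν : σ → ℕ) (x : σ →₀ ℕ) {r : ℕ} (hr : r < carry p ν x) :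
    coeffRatio p ν x / (linearForm ν (floorQuot p x) + r + 1 : ℕ) ∈ padicMultiples p p := by
  set c := linearForm ν (floorQuot p x)
  -- The carry is positive, which gives p, and c + r + 1 is one factor of the rising factorial.
  have h1 : p * (c + r + 1) ∣ carryFactor p ν x := by
    refine mul_dvd_mul (dvd_pow_self p (by omega)) ?_
    rw [Nat.ascFactorial_eq_prod_range, show c + r + 1 = c + 1 + r by ring]
    exact Finset.dvd_prod_of_mem (fun i => c + 1 + i) (Finset.mem_range.2 hr)
  have h2 := div_mem_padicMultiples (mul_mem_padicMultiples_left
    (natCast_mem_padicMultiples_of_dvd (p := p) h1) (unitFactor_mem ν x)) ((c + r + 1 : ℕ) : ℚ)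
  rwa [Nat.cast_mul, mul_div_cancel_right₀ _ (Nat.cast_ne_zero.2 (Nat.succ_ne_zero _))] at h2

theorem coeffRatio_mul_harmonic_mem (ν : σ → ℕ) (x : σ →₀ ℕ) :
    coeffRatio p ν x *
        (harmonic (linearForm ν x / p) - harmonic (linearForm ν (floorQuot p x))) ∈
      padicMultiples p p := by
  rw [← linearForm_floorQuot_add_carry (Fact.out : p.Prime).pos]
  have h (k : ℕ) (hk : k ≤ carry p ν x) : coeffRatio p ν x *
      (harmonic (linearForm ν (floorQuot p x) + k) - harmonic (linearForm ν (floorQuot p x))) ∈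
        padicMultiples p p := by
    induction k with
    | zero => simp
    | succ k ih =>
      have h1 := add_mem (ih (by omega)) (coeffRatio_div_mem ν x (r := k) (by omega))
      convert h1 using 1
      rw [← add_assoc, harmonic_succ]
      ring
  exact h _ le_rfl

end Multinomial

/-! ### The hypergeometric coefficients form a Dwork sequence -/

section HyperCoeff

variable {d k : ℕ} {p : ℕ} [Fact p.Prime] (N : Fin k → Fin d → ℕ)

theorem hyperCoeff_eq_prod_multiCoeff (m : Fin d →₀ ℕ) :
    hyperCoeff N m = ∏ j, multiCoeff (N j) m := rfl

theorem hyperCoeff_ne_zero (m : Fin d →₀ ℕ) : hyperCoeff N m ≠ 0 :=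
  (Finset.prod_pos fun j _ => multiCoeff_pos (N j) m).ne'

theorem hyperCoeff_eq (x : Fin d →₀ ℕ) :
    hyperCoeff N x = hyperCoeff N (floorQuot p x) * ∏ j, coeffRatio p (N j) x := by
  simp only [hyperCoeff_eq_prod_multiCoeff]
  rw [← Finset.prod_mul_distrib]
  exact Finset.prod_congr rfl fun j _ => multiCoeff_eq (Fact.out : p.Prime) _ _

/-- Every ratio is p-integral. For large s the quotient is 0, which yields integrality of the
coefficients themselves. -/
theorem hyperCoeff_mem_floorQuot (x : Fin d →₀ ℕ) (s : ℕ) :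
    hyperCoeff N x ∈ padicMultiples p (hyperCoeff N (floorQuot (p ^ s) x)) := by
  induction s with
  | zero => simpa using self_mem_padicMultiples (p := p) (c := hyperCoeff N x)
  | succ s ih =>
    refine padicMultiples_trans ih ?_
    rw [hyperCoeff_eq (p := p) N (floorQuot (p ^ s) x), floorQuot_floorQuot, ← pow_succ]
    exact mul_mem_padicMultiples_left self_mem_padicMultiples
      (prod_mem_padicMultiples_one _ _ fun j _ => coeffRatio_mem (N j) _)

theorem hyperCoeff_zero : hyperCoeff N 0 = 1 := by
  simp [hyperCoeff]

theorem isDworkSequence_hyperCoeff : IsDworkSequence p (hyperCoeff N) where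
  ne_zero := hyperCoeff_ne_zero N
  map_zero := hyperCoeff_zero N
  integral m := by
    have h := hyperCoeff_mem_floorQuot (p := p) N m m.degree
    rwa [floorQuot_pow_eq_zero (Fact.out : p.Prime).one_lt le_rfl, hyperCoeff_zero] at h
  congr s x n hx := by
    have hp : 0 < p := (Fact.out : p.Prime).pos
    have h1 : floorQuot p (x + p ^ (s + 1) • n) = floorQuot p x + p ^ s • n := by
      rw [pow_succ', mul_smul, floorQuot_add_smul hp]
    -- The common front factor is a multiple of `hyperCoeff N n`; the power p^(s+1) comes from the
    -- ratios.
    have h2 := hyperCoeff_mem_floorQuot (p := p) N (floorQuot p x + p ^ s • n) s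
    rw [floorQuot_add_smul (by positivity), floorQuot_floorQuot, ← pow_succ', hx, zero_add] at h2
    have h3 := prod_sub_prod_mem_padicMultiples Finset.univ
      (fun j => coeffRatio p (N j) (x + p ^ (s + 1) • n)) (fun j => coeffRatio p (N j) x)
      (fun j _ => coeffRatio_mem _ _) (fun j _ => coeffRatio_mem _ _)
      fun j _ => coeffRatio_add_smul_sub _ _ _ s
    convert mul_mem_padicMultiples h2 h3 using 1
    rotate_left
    · rw [hyperCoeff_eq (p := p) N (x + p ^ (s + 1) • n), h1, hyperCoeff_eq (p := p) N x,
        mul_div_cancel_left₀ _ (hyperCoeff_ne_zero N _)]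
      ring
    · push_cast
      rw [mul_comm]

/-- Multiplication by `hyperCoeff N x` removes the denominators of the difference of harmonic
numbers attached to the linear form of one of the vectors. -/
theorem hyperCoeff_mul_harmonic_mem (j : Fin k) (x : Fin d →₀ ℕ) :
    hyperCoeff N x *
        (harmonic (linearForm (N j) x / p) - harmonic (linearForm (N j) (floorQuot p x))) ∈
      padicMultiples p p := by
  rw [hyperCoeff_eq (p := p), ← Finset.mul_prod_erase _ _ (Finset.mem_univ j)]
  rw [show ∀ a b c e : ℚ, a * (b * c) * e = a * c * (b * e) by intros; ring]
  exact mul_mem_padicMultiples_right (mul_mem_padicMultiples_left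
      ((isDworkSequence_hyperCoeff N).integral _)
      (prod_mem_padicMultiples_one _ _ fun j _ => coeffRatio_mem _ _))
    (coeffRatio_mul_harmonic_mem _ _)

end HyperCoeff

/-! ### Functional equation of the exponential series -/

section Exp

variable {σ : Type*}

theorem exp_subst_X_add_X :
    (PowerSeries.exp ℚ).subst (MvPowerSeries.X 0 + MvPowerSeries.X 1 : MvPowerSeries (Fin 2) ℚ) =
      (PowerSeries.exp ℚ).subst (MvPowerSeries.X 0 : MvPowerSeries (Fin 2) ℚ) *
        (PowerSeries.exp ℚ).subst (MvPowerSeries.X 1 : MvPowerSeries (Fin 2) ℚ) := by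
  ext e
  rw [PowerSeries.coeff_subst_X_zero_add_X_one, PowerSeries.coeff_subst_X_zero_subst_mul_X_one]
  simp only [PowerSeries.coeff_exp, Algebra.algebraMap_self, RingHom.id_apply]
  rw [Nat.choose_symm_add, Nat.add_choose, Nat.cast_div (Nat.factorial_mul_factorial_dvd_factorial_add _ _)
    (by positivity)]
  have h1 : ((e 0)! : ℚ) ≠ 0 := by positivity
  have h2 : ((e 1)! : ℚ) ≠ 0 := by positivity
  have h3 : ((e 0 + e 1)! : ℚ) ≠ 0 := by positivity
  push_cast
  field_simp

/-- The two-variable identity, which amounts to the factorial formula for binomial coefficients, is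
specialised to a and b. -/
theorem exp_subst_add {a b : MvPowerSeries σ ℚ} (ha : MvPowerSeries.constantCoeff a = 0)
    (hb : MvPowerSeries.constantCoeff b = 0) :
    (PowerSeries.exp ℚ).subst (a + b) =
      (PowerSeries.exp ℚ).subst a * (PowerSeries.exp ℚ).subst b := by
  have hs : MvPowerSeries.HasSubst ![a, b] :=
    MvPowerSeries.hasSubst_of_constantCoeff_zero fun i => by fin_cases i <;> simp [ha, hb]
  have key (f : MvPowerSeries (Fin 2) ℚ) (hf : MvPowerSeries.constantCoeff f = 0) :
      MvPowerSeries.subst ![a, b] ((PowerSeries.exp ℚ).subst f) =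
        (PowerSeries.exp ℚ).subst (MvPowerSeries.subst ![a, b] f) := by
    rw [PowerSeries.subst, MvPowerSeries.subst_comp_subst_apply
      (PowerSeries.HasSubst.of_constantCoeff_zero hf).const hs]
    rfl
  have h := congrArg (MvPowerSeries.subst ![a, b]) exp_subst_X_add_X
  rw [MvPowerSeries.subst_mul hs, key _ (by simp), key _ (by simp), key _ (by simp),
    MvPowerSeries.subst_add hs, MvPowerSeries.subst_X hs, MvPowerSeries.subst_X hs] at h
  simpa using h

theorem exp_subst_zero : (PowerSeries.exp ℚ).subst (0 : MvPowerSeries σ ℚ) = 1 := by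
  rw [PowerSeries.subst_zero_eq_C_constantCoeff]
  simp

theorem exp_subst_nsmul {a : MvPowerSeries σ ℚ} (ha : MvPowerSeries.constantCoeff a = 0) (n : ℕ) :
    (PowerSeries.exp ℚ).subst (n • a) = (PowerSeries.exp ℚ).subst a ^ n := by
  induction n with
  | zero => rw [zero_smul, pow_zero, exp_subst_zero]
  | succ n ih => rw [succ_nsmul, exp_subst_add (by simp [ha]) ha, ih, pow_succ]

theorem constantCoeff_exp_subst {a : MvPowerSeries σ ℚ} (ha : MvPowerSeries.constantCoeff a = 0) :
    MvPowerSeries.constantCoeff ((PowerSeries.exp ℚ).subst a) = 1 := by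
  have h := PowerSeries.constantCoeff_subst_eq_zero ha (PowerSeries.exp ℚ - 1) (by simp)
  have h1 : (PowerSeries.exp ℚ - 1).subst a = (PowerSeries.exp ℚ).subst a - 1 := by
    have h2 := PowerSeries.HasSubst.of_constantCoeff_zero ha
    rw [PowerSeries.subst_sub h2, ← PowerSeries.coe_substAlgHom h2, map_one]
  rw [h1, map_sub, map_one, sub_eq_zero] at h
  exact h

end Exp

/-! ### Products with a series in z^p -/

section Expand

variable {σ R : Type*} [CommRing R] {p : ℕ} (hp : p ≠ 0)

theorem exists_smul_eq_or_not_dvd (p : ℕ) (m : σ →₀ ℕ) :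
    p • floorQuot p m = m ∨ ∃ i, ¬ p ∣ m i := by
  by_cases h : ∀ i, p ∣ m i
  · left
    ext i
    simp [Nat.mul_div_cancel' (h i)]
  · right
    simpa using h

theorem coeff_mul_expand [DecidableEq σ] {a : σ →₀ ℕ} (ha : floorQuot p a = 0) (K : σ →₀ ℕ)
    (f g : MvPowerSeries σ R) :
    MvPowerSeries.coeff (a + p • K) (f * MvPowerSeries.expand p hp g) =
      ∑ x ∈ antidiagonal K, MvPowerSeries.coeff (a + p • x.1) f * MvPowerSeries.coeff x.2 g := by
  have hp0 : 0 < p := Nat.pos_of_ne_zero hp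
  rw [MvPowerSeries.coeff_mul]
  symm
  refine Finset.sum_of_injOn (fun x => (a + p • x.1, p • x.2)) ?_ ?_ ?_ ?_
  · rintro ⟨k, l⟩ - ⟨k', l'⟩ - h
    simp only [Prod.mk.injEq, add_right_inj, nsmul_right_inj hp] at h
    exact Prod.ext h.1 h.2
  · rintro ⟨k, l⟩ h
    rw [Finset.mem_coe, Finset.HasAntidiagonal.mem_antidiagonal] at h ⊢
    rw [← h, smul_add, add_assoc]
  · rintro ⟨u, v⟩ h hn
    rw [Finset.HasAntidiagonal.mem_antidiagonal] at h
    dsimp only at h ⊢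
    obtain hv | ⟨i, hi⟩ := exists_smul_eq_or_not_dvd p v
    · refine absurd ?_ hn
      rw [← hv] at h
      have hK : floorQuot p u + floorQuot p v = K := by
        have := congrArg (floorQuot p) h
        rwa [floorQuot_add_smul hp0, floorQuot_add_smul hp0, ha, zero_add] at this
      refine ⟨(floorQuot p u, floorQuot p v), by simpa using hK, Prod.ext ?_ hv⟩
      refine add_right_cancel (b := p • floorQuot p v) ?_
      dsimp only
      rw [h, add_assoc, ← smul_add, hK]
    · rw [MvPowerSeries.coeff_expand_of_not_dvd p hp g hi, mul_zero]
  · rintro ⟨k, l⟩ -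
    rw [MvPowerSeries.coeff_expand_smul]

end Expand

/-! ### Frobenius congruence and Dwork's lemma -/

section Integrality

variable {σ : Type*} {p : ℕ} [Fact p.Prime] {c : ℚ}

/-- All coefficients of the power series `f` are `p`-adic multiples of `c`. -/
def CoeffsMem (p : ℕ) [Fact p.Prime] (c : ℚ) (f : MvPowerSeries σ ℚ) : Prop :=
  ∀ m, MvPowerSeries.coeff m f ∈ padicMultiples p c

theorem CoeffsMem.mul {a b : ℚ} {f g : MvPowerSeries σ ℚ} (hf : CoeffsMem p a f)
    (hg : CoeffsMem p b g) : CoeffsMem p (a * b) (f * g) := fun m => by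
  classical
  rw [MvPowerSeries.coeff_mul]
  exact sum_mem fun x _ => mul_mem_padicMultiples (hf x.1) (hg x.2)

theorem CoeffsMem.add {f g : MvPowerSeries σ ℚ} (hf : CoeffsMem p c f) (hg : CoeffsMem p c g) :
    CoeffsMem p c (f + g) := fun m => by
  rw [map_add]
  exact add_mem (hf m) (hg m)

theorem CoeffsMem.one : CoeffsMem p 1 (1 : MvPowerSeries σ ℚ) := fun m => by
  classical
  rw [MvPowerSeries.coeff_one]
  split_ifs
  · exact self_mem_padicMultiples
  · exact zero_mem _

theorem CoeffsMem.pow {f : MvPowerSeries σ ℚ} (hf : CoeffsMem p c f) (n : ℕ) :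
    CoeffsMem p (c ^ n) (f ^ n) := by
  induction n with
  | zero => simpa using CoeffsMem.one
  | succ n ih => simpa only [pow_succ] using ih.mul hf

/-- The ring of rational numbers that are `p`-adically integral. -/
def padicIntegralSubring (p : ℕ) [Fact p.Prime] : Subring ℚ where
  __ := padicMultiples p 1
  one_mem' := self_mem_padicMultiples
  mul_mem' := mul_mem_padicMultiples_left

/-- The inclusion of the `p`-adically integral rational numbers in the `p`-adic integers. -/
noncomputable def padicIntegralSubring.toPadicInt (p : ℕ) [Fact p.Prime] :
    padicIntegralSubring p →+* ℤ_[p] where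
  toFun x := ⟨((x : ℚ) : ℚ_[p]), by
    rw [Padic.eq_padicNorm]
    exact_mod_cast mem_padicMultiples_one.1 x.2⟩
  map_one' := Subtype.ext (by simp)
  map_mul' x y := Subtype.ext (Rat.cast_mul (x : ℚ) y)
  map_zero' := Subtype.ext (by simp)
  map_add' x y := Subtype.ext (Rat.cast_add (x : ℚ) y)

theorem mem_padicMultiples_of_toZMod_eq_zero (x : padicIntegralSubring p)
    (hx : PadicInt.toZMod (padicIntegralSubring.toPadicInt p x) = 0) :
    (x : ℚ) ∈ padicMultiples p p := by
  rw [← RingHom.mem_ker, PadicInt.ker_toZMod, PadicInt.maximalIdeal_eq_span_p,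
    Ideal.mem_span_singleton] at hx
  have h1 := (PadicInt.norm_le_pow_iff_mem_span_pow _ 1).2
    (Ideal.mem_span_singleton.2 (by simpa using hx))
  rw [mem_padicMultiples, padicNorm.padicNorm_p_of_prime]
  have h2 : ‖((x : ℚ) : ℚ_[p])‖ ≤ (p : ℝ) ^ (-(1 : ℕ) : ℤ) := h1
  rw [Padic.eq_padicNorm] at h2
  rw [← Rat.cast_le (K := ℝ)]
  simpa using h2

/-- The Frobenius congruence for power series with `p`-adically integral coefficients. -/
theorem CoeffsMem.pow_sub_expand (hp : p ≠ 0) {f : MvPowerSeries σ ℚ} (hf : CoeffsMem p 1 f) :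
    CoeffsMem p p (f ^ p - MvPowerSeries.expand p hp f) := by
  set f' : MvPowerSeries σ (padicIntegralSubring p) := fun m => ⟨MvPowerSeries.coeff m f, hf m⟩
  have hf' : MvPowerSeries.map (padicIntegralSubring p).subtype f' = f := by
    ext m
    rw [MvPowerSeries.coeff_map]
    rfl
  set ψ := (PadicInt.toZMod (p := p)).comp (padicIntegralSubring.toPadicInt p)
  -- Over Z/p the p-th power of a series is its expansion, Frobenius being trivial on coefficients.
  have h0 : MvPowerSeries.map ψ (f' ^ p - MvPowerSeries.expand p hp f') = 0 := by
    rw [map_sub, map_pow, MvPowerSeries.map_expand, ← MvPowerSeries.map_frobenius_expand p hp,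
      ZMod.frobenius_zmod, MvPowerSeries.map_id, RingHom.id_apply, sub_self]
  intro m
  have h1 : f ^ p - MvPowerSeries.expand p hp f =
      MvPowerSeries.map (padicIntegralSubring p).subtype
        (f' ^ p - MvPowerSeries.expand p hp f') := by
    rw [map_sub, map_pow, MvPowerSeries.map_expand, hf']
  rw [h1, MvPowerSeries.coeff_map]
  refine mem_padicMultiples_of_toZMod_eq_zero _ ?_
  have h2 := congrArg (MvPowerSeries.coeff m) h0
  rw [MvPowerSeries.coeff_map, map_zero] at h2
  exact h2

/-- This is the bound v_p(n!) < n for n ≠ 0. -/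
theorem pow_div_factorial_mem {n : ℕ} (hn : n ≠ 0) :
    (p ^ n / n ! : ℚ) ∈ padicMultiples p p := by
  have hp : p.Prime := Fact.out
  have hp0 : (p : ℚ) ≠ 0 := by exact_mod_cast hp.ne_zero
  have hn0 : (n ! : ℚ) ≠ 0 := by positivity
  have h1 := padicValNat_factorial_lt_of_ne_zero (p := p) hn
  rw [mem_padicMultiples, padicNorm.padicNorm_p_of_prime,
    padicNorm.eq_zpow_of_nonzero (div_ne_zero (pow_ne_zero _ hp0) hn0),
    padicValRat.div (pow_ne_zero _ hp0) hn0, padicValRat.pow, padicValRat.self hp.one_lt,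
    padicValRat.of_nat, ← zpow_neg_one]
  refine zpow_le_zpow_right₀ (by exact_mod_cast hp.one_lt.le) ?_
  omega

theorem exp_subst_sub_one_mem {f : MvPowerSeries σ ℚ} (hf : CoeffsMem p p f)
    (hf0 : MvPowerSeries.constantCoeff f = 0) :
    CoeffsMem p p ((PowerSeries.exp ℚ).subst f - 1) := by
  intro m
  classical
  rcases eq_or_ne m 0 with rfl | hm
  · rw [MvPowerSeries.coeff_zero_eq_constantCoeff_apply, map_sub, constantCoeff_exp_subst hf0]
    simp
  rw [map_sub, PowerSeries.coeff_subst (PowerSeries.HasSubst.of_constantCoeff_zero hf0),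
    MvPowerSeries.coeff_one, if_neg hm, sub_zero]
  refine finsum_induction (· ∈ padicMultiples p p) (zero_mem _) (fun _ _ => add_mem) fun n => ?_
  rcases eq_or_ne n 0 with rfl | hn
  · rw [pow_zero, MvPowerSeries.coeff_one, if_neg hm, smul_zero]
    exact zero_mem _
  · refine padicMultiples_trans ?_ (pow_div_factorial_mem hn)
    have h := div_mem_padicMultiples (hf.pow n m) (n ! : ℚ)
    simpa [div_eq_inv_mul] using h

theorem coeff_mul_of_forall_lt {f g : MvPowerSeries σ ℚ} {m : σ →₀ ℕ}
    (h : ∀ n < m, MvPowerSeries.coeff n g = 0) :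
    MvPowerSeries.coeff m (f * g) =
      MvPowerSeries.constantCoeff f * MvPowerSeries.coeff m g := by
  classical
  rw [MvPowerSeries.coeff_mul, Finset.sum_eq_single (0, m)]
  · rfl
  · rintro ⟨u, v⟩ huv hne
    rw [Finset.HasAntidiagonal.mem_antidiagonal] at huv
    dsimp only at huv ⊢
    rw [h v, mul_zero]
    rw [← huv]
    refine lt_add_of_pos_left _ (pos_iff_ne_zero.2 ?_)
    rintro rfl
    rw [zero_add] at huv
    exact hne (by rw [huv])
  · intro h'
    simp at h'

/-- Dwork's lemma: if `g(z^p) - p g(z)` is divisible by `p`, then `exp g` is `p`-adically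
integral. -/
theorem exp_subst_mem (hp : p ≠ 0) {g : MvPowerSeries σ ℚ}
    (hg0 : MvPowerSeries.constantCoeff g = 0)
    (hg : CoeffsMem p p (MvPowerSeries.expand p hp g - p • g)) :
    CoeffsMem p 1 ((PowerSeries.exp ℚ).subst g) := by
  have hp0 : (p : ℚ) ≠ 0 := by exact_mod_cast hp
  set E := (PowerSeries.exp ℚ).subst g with hE
  have hE0 : MvPowerSeries.constantCoeff E = 1 := constantCoeff_exp_subst hg0
  set D := MvPowerSeries.expand p hp g - p • g with hD
  have hD0 : MvPowerSeries.constantCoeff D = 0 := by simp [hD, hg0]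
  set E' := (PowerSeries.exp ℚ).subst D
  have hE' : CoeffsMem p p (E' - 1) := exp_subst_sub_one_mem hg hD0
  have hE'0 : MvPowerSeries.constantCoeff E' = 1 := constantCoeff_exp_subst hD0
  have hexp : MvPowerSeries.expand p hp E = E ^ p * E' := by
    rw [hE, PowerSeries.expand_subst _ hp (PowerSeries.HasSubst.of_constantCoeff_zero hg0),
      ← exp_subst_nsmul hg0, ← exp_subst_add (by simp [hg0]) hD0, hD, add_sub_cancel]
  intro m
  induction m using WellFoundedLT.induction with
  | _ m ih =>
  rcases eq_or_ne m 0 with rfl | hm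
  · rw [MvPowerSeries.coeff_zero_eq_constantCoeff_apply, hE0]
    exact self_mem_padicMultiples
  classical
  -- The part of E strictly below m, integral by induction.
  set T : MvPowerSeries σ ℚ := fun n => if n < m then MvPowerSeries.coeff n E else 0 with hTdef
  have hT (n : σ →₀ ℕ) :
      MvPowerSeries.coeff n T = if n < m then MvPowerSeries.coeff n E else 0 := rfl
  have hT0 : MvPowerSeries.constantCoeff T = 1 := by
    rw [← MvPowerSeries.coeff_zero_eq_constantCoeff_apply, hT, if_pos (pos_iff_ne_zero.2 hm),
      MvPowerSeries.coeff_zero_eq_constantCoeff_apply, hE0]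
  have hTint : CoeffsMem p 1 T := fun n => by
    rw [hT]
    split_ifs with h
    · exact ih n h
    · exact zero_mem _
  have hδ (n : σ →₀ ℕ) (h : n < m) : MvPowerSeries.coeff n (E - T) = 0 := by
    rw [map_sub, hT, if_pos h, sub_self]
  have hδm : MvPowerSeries.coeff m (E - T) = MvPowerSeries.coeff m E := by
    rw [map_sub, hT, if_neg (lt_irrefl m), sub_zero]
  have h1 : MvPowerSeries.coeff m ((E ^ p - T ^ p) * E') = p * MvPowerSeries.coeff m E := by
    -- E - T vanishes below m, and its cofactor in E^p - T^p has constant term p.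
    rw [← geom_sum₂_mul, mul_right_comm, coeff_mul_of_forall_lt hδ, hδm]
    simp [map_sum, hE0, hT0, hE'0]
  have h2 : MvPowerSeries.coeff m (MvPowerSeries.expand p hp (E - T)) = 0 := by
    -- The coefficient is zero unless p divides m, and then it is that of E - T at m/p < m.
    obtain h | ⟨i, hi⟩ := exists_smul_eq_or_not_dvd p m
    · rw [← h, MvPowerSeries.coeff_expand_smul]
      refine hδ _ (lt_of_le_of_ne ?_ fun h' => hm ?_)
      · intro i
        exact Nat.div_le_self _ _
      · have hp1 : 1 < p := (Fact.out : p.Prime).one_lt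
        ext i
        have h3 := DFunLike.congr_fun h' i
        rw [floorQuot_apply] at h3
        by_contra h4
        exact (Nat.div_lt_self (Nat.pos_of_ne_zero h4) hp1).ne h3
    · exact MvPowerSeries.coeff_expand_of_not_dvd p hp _ hi
  have h3 : CoeffsMem p p (T ^ p * (E' - 1)) := by
    simpa using (hTint.pow p).mul hE'
  have h4 : p * MvPowerSeries.coeff m E ∈ padicMultiples p (p * 1) := by
    have h5 : (E ^ p - T ^ p) * E' = MvPowerSeries.expand p hp (E - T) -
        (T ^ p - MvPowerSeries.expand p hp T) - T ^ p * (E' - 1) := by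
      rw [map_sub, hexp]
      ring
    rw [← h1, h5, map_sub, map_sub, h2, zero_sub, mul_one]
    exact sub_mem (neg_mem (hTint.pow_sub_expand hp m)) (h3 m)
  have h6 := div_mem_padicMultiples h4 (p : ℚ)
  rwa [mul_div_cancel_left₀ _ hp0, mul_div_cancel_left₀ _ hp0] at h6

end Integrality

section OfCoeffs

variable {σ R : Type*} [Semiring R]

/-- The power series with prescribed coefficients. -/
def ofCoeffs (A : (σ →₀ ℕ) → R) : MvPowerSeries σ R := A

@[simp]
theorem coeff_ofCoeffs (A : (σ →₀ ℕ) → R) (m : σ →₀ ℕ) :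
    MvPowerSeries.coeff m (ofCoeffs A) = A m := rfl

end OfCoeffs

/-! ### Dwork's criterion for exp(g/f) -/

section Integrality

variable {σ : Type*} {p : ℕ} [Fact p.Prime] {c : ℚ}

theorem CoeffsMem.expand (hp : p ≠ 0) {f : MvPowerSeries σ ℚ} (hf : CoeffsMem p c f) :
    CoeffsMem p c (MvPowerSeries.expand p hp f) := fun m => by
  obtain h | ⟨i, hi⟩ := exists_smul_eq_or_not_dvd p m
  · rw [← h, MvPowerSeries.coeff_expand_smul]
    exact hf _
  · rw [MvPowerSeries.coeff_expand_of_not_dvd p hp f hi]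
    exact zero_mem _

theorem CoeffsMem.inv {f : MvPowerSeries σ ℚ} (hf : CoeffsMem p 1 f)
    (hf0 : MvPowerSeries.constantCoeff f = 1) : CoeffsMem p 1 f⁻¹ := by
  classical
  intro m
  induction m using WellFoundedLT.induction with
  | _ m ih =>
  rw [MvPowerSeries.coeff_inv, hf0, inv_one]
  split_ifs
  · exact self_mem_padicMultiples
  · rw [neg_one_mul]
    refine neg_mem (sum_mem fun x _ => ?_)
    split_ifs with h
    · exact mul_mem_padicMultiples_left (hf _) (ih _ h)
    · exact zero_mem _

/-- The power series `g` for which `f(z) g(z^p) - p f(z^p) g(z)` is divisible by `p`. -/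
def dworkAddSubgroup (p : ℕ) [Fact p.Prime] (hp : p ≠ 0) (f : MvPowerSeries σ ℚ) :
    AddSubgroup (MvPowerSeries σ ℚ) where
  carrier := {g | CoeffsMem p p
    (f * MvPowerSeries.expand p hp g - p • (g * MvPowerSeries.expand p hp f))}
  zero_mem' m := by simp
  add_mem' {g h} hg hh := by
    rw [Set.mem_ofPred_eq] at hg hh ⊢
    convert hg.add hh using 1
    rw [map_add, mul_add, add_mul, smul_add]
    abel
  neg_mem' {g} hg m := by
    convert neg_mem (hg m) using 1
    rw [← map_neg, map_neg, mul_neg, neg_mul, smul_neg, neg_sub, sub_neg_eq_add, neg_add_eq_sub]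

theorem mem_dworkAddSubgroup {hp : p ≠ 0} {f g : MvPowerSeries σ ℚ} :
    g ∈ dworkAddSubgroup p hp f ↔ CoeffsMem p p
      (f * MvPowerSeries.expand p hp g - p • (g * MvPowerSeries.expand p hp f)) := Iff.rfl

theorem exp_subst_mul_inv_mem {hp : p ≠ 0} {f g : MvPowerSeries σ ℚ} (hf : CoeffsMem p 1 f)
    (hf0 : MvPowerSeries.constantCoeff f = 1) (hg0 : MvPowerSeries.constantCoeff g = 0)
    (hg : g ∈ dworkAddSubgroup p hp f) : CoeffsMem p 1 ((PowerSeries.exp ℚ).subst (g * f⁻¹)) := by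
  refine exp_subst_mem hp (by simp [hg0]) ?_
  have hff : f * f⁻¹ = 1 := MvPowerSeries.mul_inv_cancel _ (by simp [hf0])
  have hff' : MvPowerSeries.expand p hp f * MvPowerSeries.expand p hp f⁻¹ = 1 := by
    rw [← map_mul, hff, map_one]
  have h := ((mem_dworkAddSubgroup.1 hg).mul (hf.inv hf0)).mul ((hf.inv hf0).expand hp)
  rw [mul_one, mul_one] at h
  convert h using 1
  rw [map_mul, nsmul_eq_mul, nsmul_eq_mul]
  linear_combination (-(MvPowerSeries.expand p hp g * MvPowerSeries.expand p hp f⁻¹)) * hff +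
    p * g * f⁻¹ * hff'

end Integrality

/-! ### Series with harmonic weights -/

section HarmonicSeries

variable {σ : Type*} {p : ℕ} [Fact p.Prime] {A : (σ →₀ ℕ) → ℚ}

/-- The factor p^s brings both arguments down to L(m) and p L(⌊m/p⌋); one further p leaves exactly
the difference handled by `hL`. -/
theorem IsDworkSequence.harmonic_weight_mem (hA : IsDworkSequence p A) (L : (σ →₀ ℕ) →+ ℕ)
    (hL : ∀ x, A x * (harmonic (L x / p) - harmonic (L (floorQuot p x))) ∈ padicMultiples p p)
    (s : ℕ) (m : σ →₀ ℕ) :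
    (harmonic (L (p ^ s • m)) - harmonic (L (p ^ (s + 1) • floorQuot p m))) *
      (p ^ (s + 1) * A m) ∈ padicMultiples p p := by
  have hpm : (p * A m : ℚ) ∈ padicMultiples p 1 :=
    mul_mem_padicMultiples_right (natCast_mem_padicMultiples_one p) (hA.integral m)
  have h1 := mul_mem_padicMultiples_left (pow_mul_harmonic_sub_mem (p := p) s (L m)) hpm
  have h2 := mul_mem_padicMultiples_left
    (pow_mul_harmonic_sub_mem (p := p) s (p * L (floorQuot p m))) hpm
  have h3 := mul_mem_padicMultiples_left (mul_harmonic_sub_mem (p := p) (L m)) (hA.integral m)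
  have h4 := mul_mem_padicMultiples_left
    (mul_harmonic_sub_mem (p := p) (p * L (floorQuot p m))) (hA.integral m)
  rw [Nat.mul_div_cancel_left _ (Fact.out : p.Prime).pos] at h4
  convert add_mem (sub_mem (add_mem (sub_mem h1 h2) h3) h4) (hL m) using 1
  rw [map_nsmul, map_nsmul, smul_eq_mul, smul_eq_mul, pow_succ p, mul_assoc]
  ring

theorem IsDworkSequence.harmonicSeries_mem (hA : IsDworkSequence p A) (hp : p ≠ 0)
    (L : (σ →₀ ℕ) →+ ℕ)
    (hL : ∀ x, A x * (harmonic (L x / p) - harmonic (L (floorQuot p x))) ∈ padicMultiples p p) :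
    ofCoeffs (fun m => harmonic (L m) * A m) ∈ dworkAddSubgroup p hp (ofCoeffs A) := by
  classical
  have hp0 : 0 < p := Nat.pos_of_ne_zero hp
  rw [mem_dworkAddSubgroup]
  intro n
  obtain ⟨a, K, ha, rfl⟩ : ∃ a K, floorQuot p a = 0 ∧ a + p • K = n := by
    refine ⟨n - p • floorQuot p n, floorQuot p n, ?_, tsub_add_cancel_of_le (smul_floorQuot_le p n)⟩
    have h := floorQuot_add_smul hp0 (n - p • floorQuot p n) (floorQuot p n)
    rw [tsub_add_cancel_of_le (smul_floorQuot_le p n)] at h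
    simpa using h.symm
  rw [map_sub, map_nsmul, coeff_mul_expand hp ha, coeff_mul_expand hp ha]
  simp only [coeff_ofCoeffs]
  have h1 := hA.sum_weight_mem ha (fun m => harmonic (L m)) (hA.harmonic_weight_mem L hL) K
  have h2 : ∑ x ∈ antidiagonal K, A (a + p • x.1) * (harmonic (L x.2) * A x.2) =
      ∑ x ∈ antidiagonal K, A (a + p • x.2) * (harmonic (L x.1) * A x.1) := by
    conv_lhs => rw [← Finset.HasAntidiagonal.map_swap_antidiagonal, Finset.sum_map]
    rfl
  -- Here p H_{L(a+pk)} is replaced by H_{L(k)}; `hL` absorbs the carry from ⌊L(a+pk)/p⌋ to L(k).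
  have h3 : ∑ x ∈ antidiagonal K, (A (a + p • x.1) * harmonic (L x.1) * A x.2 -
      p * (harmonic (L (a + p • x.1)) * A (a + p • x.1) * A x.2)) ∈ padicMultiples p p := by
    refine sum_mem fun x _ => ?_
    have h4 := hL (a + p • x.1)
    rw [floorQuot_add_smul hp0, ha, zero_add] at h4
    have h5 := mul_mem_padicMultiples_left (mul_harmonic_sub_mem (p := p) (L (a + p • x.1)))
      (hA.integral (a + p • x.1))
    convert mul_mem_padicMultiples_left (neg_mem (add_mem h4 h5)) (hA.integral x.2) using 1
    ring
  convert add_mem h1 h3 using 1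
  rw [h2, nsmul_eq_mul, Finset.mul_sum, ← Finset.sum_sub_distrib, ← Finset.sum_add_distrib]
  refine Finset.sum_congr rfl fun x _ => ?_
  rw [dworkTerm]
  ring

end HarmonicSeries

/-! ### Integrality of the canonical coordinates -/

section CanonicalCoord

variable {d k : ℕ} (N : Fin k → Fin d → ℕ) (i : Fin d)

theorem G_eq : G N i =
    ∑ j, N j i • ofCoeffs (fun m => harmonic (linearForm (N j) m) * hyperCoeff N m) -
    (∑ j, N j i) • ofCoeffs (fun m => harmonic (Finsupp.applyAddHom i m) * hyperCoeff N m) := by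
  ext m
  rw [map_sub, map_sum, map_nsmul]
  simp only [map_nsmul, coeff_ofCoeffs]
  simp only [nsmul_eq_mul]
  change (∑ j, (N j i : ℚ) * harmonic (linearForm (N j) m) -
    harmonic (m i) * ∑ j, (N j i : ℚ)) * hyperCoeff N m = _
  rw [sub_mul, Finset.sum_mul]
  simp only [mul_assoc, Nat.cast_sum, Finsupp.applyAddHom_apply]
  ring

theorem G_mem_dworkAddSubgroup {p : ℕ} [Fact p.Prime] (hp : p ≠ 0) :
    G N i ∈ dworkAddSubgroup p hp (F N) := by
  change G N i ∈ dworkAddSubgroup p hp (ofCoeffs (hyperCoeff N))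
  have hA := isDworkSequence_hyperCoeff (p := p) N
  rw [G_eq]
  refine sub_mem (sum_mem fun j _ => nsmul_mem ?_ _) (nsmul_mem ?_ _)
  · exact hA.harmonicSeries_mem hp _ fun x => hyperCoeff_mul_harmonic_mem N j x
  · refine hA.harmonicSeries_mem hp _ fun x => ?_
    -- A coordinate commutes with the quotient by p, so no carry arises.
    simp only [Finsupp.applyAddHom_apply, floorQuot_apply, sub_self, mul_zero]
    exact zero_mem _

theorem canonicalCoord_coeffsMem (p : ℕ) [Fact p.Prime] : CoeffsMem p 1 (canonicalCoord N i) := by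
  classical
  have hp : p ≠ 0 := (Fact.out : p.Prime).ne_zero
  have hX : CoeffsMem p 1 (MvPowerSeries.X i : MvPowerSeries (Fin d) ℚ) := fun m => by
    rw [MvPowerSeries.coeff_X]
    split_ifs
    · exact self_mem_padicMultiples
    · exact zero_mem _
  have hF : CoeffsMem p 1 (F N) := fun m => (isDworkSequence_hyperCoeff N).integral m
  have h := hX.mul (exp_subst_mul_inv_mem hF (constantCoeff_F N) (constantCoeff_G N i)
    (G_mem_dworkAddSubgroup N i hp))
  rwa [mul_one] at h

end CanonicalCoord

/-- A rational number that is `p`-adically integral for all primes `p` is an integer. -/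
theorem exists_intCast_eq_of_forall_prime {q : ℚ}
    (h : ∀ (p : ℕ) [Fact p.Prime], q ∈ padicMultiples p 1) : ∃ n : ℤ, (n : ℚ) = q := by
  refine ⟨q.num, (Rat.den_eq_one_iff q).1 ?_⟩
  by_contra hden
  obtain ⟨p, hp, hpd⟩ := Nat.exists_prime_and_dvd hden
  have := Fact.mk hp
  have h1 : padicNorm p q * padicNorm p (q.den : ℚ) = padicNorm p (q.num : ℚ) := by
    rw [← padicNorm.mul, Rat.mul_den_eq_num]
  have h2 : padicNorm p (q.num : ℚ) = 1 := by
    rw [padicNorm.int_eq_one_iff, Int.natCast_dvd]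
    exact fun h3 => hp.one_lt.ne' (Nat.eq_one_of_dvd_coprimes q.reduced h3 hpd)
  have h3 := (padicNorm.nat_lt_one_iff (p := p) q.den).2 hpd
  have h4 := mem_padicMultiples_one.1 (h p)
  rw [h2] at h1
  nlinarith [padicNorm.nonneg (p := p) (q.den : ℚ)]

end MirrorMap

theorem mainTheorem2 {d k : ℕ} (hd : 0 < d) (hk : 0 < k) (N : Fin k → Fin d → ℕ) (i : Fin d) :
    MirrorMap.canonicalCoord N i ∈
      (MvPowerSeries.map (σ := Fin d) (Int.castRingHom ℚ)).range := by
  choose c hc using fun m => MirrorMap.exists_intCast_eq_of_forall_prime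
    fun p _ => MirrorMap.canonicalCoord_coeffsMem N i p m
  refine ⟨MirrorMap.ofCoeffs c, MvPowerSeries.ext fun m => ?_⟩
  rw [MvPowerSeries.coeff_map]
  exact hc m
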